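/- Let $n\ge 1$, let $M$ be a smooth manifold, and let $\omega\in\Omega^{n+1}(M)$ be closed, so that $(M,\omega)$ is a pre-$n$-plectic manifold. A form $\alpha\in\Omega^{n-1}(M)$ is Hamiltonian if there is a vector field $v_\alpha$ (a Hamiltonian vector field for $\alpha$) with $d\alpha=-\iota_{v_\alpha}\omega$. The Lie $n$-algebra of observables $L_\infty(M,\omega)$ is the graded vector space $L=\bigoplus_{i=0}^{n-1}L_i$ with $L_0=\Omega^{n-1}_{Ham}(M)$ the space of Hamiltonian forms and $L_i=\Omega^{n-1-i}(M)$ for $0<i\le n-1$, together with the multilinear brackets $l_k$, $k\ge 1$, given as follows on homogeneous elements: $l_1(\alpha)=d\alpha$ if $\deg\alpha>0$ and $l_1(\alpha)=0$ if $\deg\alpha=0$; for $k\ge 2$, $l_k(\alpha_1,\dots,\alpha_k)=-(-1)^{k(k+1)/2}\,\iota_{v_{\alpha_k}}\cdots\iota_{v_{\alpha_1}}\omega$ if all $\alpha_j$ have degree $0$, where $v_{\alpha_j}$ is any Hamiltonian vector field for $\alpha_j$ (the result does not depend on the choice), and $l_k(\alpha_1,\dots,\alpha_k)=0$ otherwise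 (so $l_k=0$ for $k>n+1$). An $L_\infty$-subalgebra of $L_\infty(M,\omega)$ is a graded linear subspace closed under all the brackets $l_k$. Let $v$ be a vector field on $M$ with $\mathcal L_v\omega=0$. Let $\mathcal C_{loc}(v)$, $\mathcal C(v)$ and $\mathcal C_{str}(v)$ be the graded vector spaces of the forms $\alpha\in\Omega^\bullet(M)$ for which $\mathcal L_v\alpha$ is closed, exact and zero, respectively (the locally, globally and strictly conserved quantities). Then $$L_\infty(M,\omega)\cap\mathcal C_{loc}(v),\qquad L_\infty(M,\omega)\cap\mathcal C(v),\qquad L_\infty(M,\omega)\cap\mathcal C_{str}(v)$$ are $L_\infty$-subalgebras of $L_\infty(M,\omega)$. Moreover, $\mathcal L_v\bigl(l_k(\beta_1,\dots,\beta_k)\bigr)=0$ for all $k\ge 1$ and all $\beta_1,\dots,\beta_k\in L_\infty(M,\omega)\cap\mathcal C_{loc}(v)$. -/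

import Mathlib

open scoped Manifold Topology

noncomputable section

namespace Multisymplectic

/-! ### Linear algebra of alternating forms on one vector space -/

section Linear

variable {V : Type*} [AddCommGroup V] [Module ℝ V] [TopologicalSpace V]

/-- Contraction of an alternating form with a vector in the first slot:
`(contractVec a f) (w₁, …, w_p) = f (a, w₁, …, w_p)`. -/
def contractVec {p : ℕ} (a : V) (f : V [⋀^Fin (p + 1)]→L[ℝ] ℝ) : V [⋀^Fin p]→L[ℝ] ℝ :=
  { f.toAlternatingMap.curryLeft a with
    cont := f.cont.comp
      (show Continuous fun w : Fin p → V => (Fin.cons a w : Fin (p + 1) → V) from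
        continuous_const.finCons continuous_id) }

theorem contractVec_apply {p : ℕ} (a : V) (f : V [⋀^Fin (p + 1)]→L[ℝ] ℝ) (w : Fin p → V) :
    contractVec a f w = f (Fin.cons a w) := rfl

/-- The derivation action of an endomorphism `A` on an alternating form:
`(derivAct A f) (w₁, …, w_p) = ∑ i, f (w₁, …, A wᵢ, …, w_p)`. -/
def derivAct {p : ℕ} (A : V →L[ℝ] V) (f : V [⋀^Fin p]→L[ℝ] ℝ) : V [⋀^Fin p]→L[ℝ] ℝ :=
  { ∑ i : Fin p, f.toContinuousMultilinearMap.compContinuousLinearMap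
      (fun j => if j = i then A else ContinuousLinearMap.id ℝ V) with
    map_eq_zero_of_eq' := by
      intro w a b hab hne
      have key : ∀ i : Fin p, (fun j => (if j = i then A else ContinuousLinearMap.id ℝ V) (w j))
          = Function.update w i (A (w i)) := by
        intro i
        funext j
        by_cases h : j = i
        · subst h; simp
        · simp [h]
      have hsum : ∑ i : Fin p, f (Function.update w i (A (w i))) = 0 := by
        rw [← Finset.add_sum_erase _ _ (Finset.mem_univ a),
          ← Finset.add_sum_erase _ _ (Finset.mem_erase.2 ⟨hne.symm, Finset.mem_univ b⟩),
          Finset.sum_eq_zero, add_zero]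
        · have hs : Function.update w b (A (w b))
              = Function.update w a (A (w a)) ∘ Equiv.swap a b := by
            funext j
            by_cases h1 : j = a
            · subst h1; simp [hne, hne.symm, hab]
            · by_cases h2 : j = b
              · subst h2; simp [hab]
              · simp [h1, h2, Equiv.swap_apply_of_ne_of_ne h1 h2]
          have := f.toAlternatingMap.map_swap (Function.update w a (A (w a))) hne
          rw [hs]
          simp only [ContinuousAlternatingMap.coe_toAlternatingMap] at this
          rw [this, add_neg_cancel]
        · intro i hi
          simp only [Finset.mem_erase, Finset.mem_univ, and_true] at hi
          refine f.map_eq_zero_of_eq _ (i := a) (j := b) ?_ hne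
          rw [Function.update_of_ne (Ne.symm hi.2), Function.update_of_ne (Ne.symm hi.1), hab]
      simpa [key] using hsum }

theorem derivAct_apply {p : ℕ} (A : V →L[ℝ] V) (f : V [⋀^Fin p]→L[ℝ] ℝ) (w : Fin p → V) :
    derivAct A f w = ∑ i, f (Function.update w i (A (w i))) := by
  have key : ∀ i : Fin p, (fun j => (if j = i then A else ContinuousLinearMap.id ℝ V) (w j))
      = Function.update w i (A (w i)) := by
    intro i
    funext j
    by_cases h : j = i
    · subst h; simp
    · simp [h]
  change (∑ i : Fin p, f.toContinuousMultilinearMap.compContinuousLinearMap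
      (fun j => if j = i then A else ContinuousLinearMap.id ℝ V)) w = _
  simp [key]

end Linear

/-! ### Vector fields and differential forms on a manifold modelled on `E` -/

section Manifold

variable (E : Type*) [NormedAddCommGroup E] [NormedSpace ℝ E]
  (M : Type*) [TopologicalSpace M] [ChartedSpace E M]

/-- Not necessarily smooth vector fields on `M`. -/
abbrev VField : Type _ := ∀ x : M, TangentSpace 𝓘(ℝ, E) x

/-- Not necessarily smooth differential forms of degree `p` on `M`. -/
abbrev DForm (p : ℕ) : Type _ := ∀ x : M, (TangentSpace 𝓘(ℝ, E) x) [⋀^Fin p]→L[ℝ] ℝ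

/-- Not necessarily homogeneous forms, given by their components of all degrees. -/
abbrev GForm : Type _ := ∀ p : ℕ, DForm E M p

variable {E M}

/-- Smooth vector fields: smooth sections of the tangent bundle. -/
def VField.IsSmooth [IsManifold 𝓘(ℝ, E) ((⊤ : ℕ∞) : WithTop ℕ∞) M] (v : VField E M) : Prop :=
  ContMDiff 𝓘(ℝ, E) 𝓘(ℝ, E).tangent ((⊤ : ℕ∞) : WithTop ℕ∞)
    (fun x => (⟨x, v x⟩ : TangentBundle 𝓘(ℝ, E) M))

/-- The coordinate expression of a form in the chart around `x₀`: its pullback under the inverse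
of the chart. It is meaningful on the target of the chart. -/
def DForm.coord {p : ℕ} (α : DForm E M p) (x₀ : M) (y : E) : E [⋀^Fin p]→L[ℝ] ℝ :=
  (α ((extChartAt 𝓘(ℝ, E) x₀).symm y)).compContinuousLinearMap
    (mfderiv 𝓘(ℝ, E) 𝓘(ℝ, E) (extChartAt 𝓘(ℝ, E) x₀).symm y)

/-- The coordinate expression of a vector field in the chart around `x₀`: its pushforward under
the chart. It is meaningful on the target of the chart. -/
def VField.coord (v : VField E M) (x₀ : M) (y : E) : E :=
  mfderiv 𝓘(ℝ, E) 𝓘(ℝ, E) (extChartAt 𝓘(ℝ, E) x₀) ((extChartAt 𝓘(ℝ, E) x₀).symm y)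
    (v ((extChartAt 𝓘(ℝ, E) x₀).symm y))

/-- The value at `x₀` of a form whose coordinate expression, in the chart around `x₀`, takes the
value `f` at the point corresponding to `x₀`. -/
def ofCoordAt {p : ℕ} (x₀ : M) (f : E [⋀^Fin p]→L[ℝ] ℝ) :
    (TangentSpace 𝓘(ℝ, E) x₀) [⋀^Fin p]→L[ℝ] ℝ :=
  f.compContinuousLinearMap (mfderiv 𝓘(ℝ, E) 𝓘(ℝ, E) (extChartAt 𝓘(ℝ, E) x₀) x₀)

/-- Smooth forms: the coordinate expressions are smooth. -/
def DForm.IsSmooth {p : ℕ} (α : DForm E M p) : Prop :=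
  ∀ x₀ : M, ContDiffOn ℝ ((⊤ : ℕ∞) : WithTop ℕ∞) (α.coord x₀) (extChartAt 𝓘(ℝ, E) x₀).target

/-- The exterior derivative, computed in a chart around each point. -/
def DForm.d {p : ℕ} (α : DForm E M p) : DForm E M (p + 1) := fun x =>
  ofCoordAt x (extDeriv (α.coord x) (extChartAt 𝓘(ℝ, E) x x))

/-- The interior product `ι_v α = α(v, ·, …, ·)`. -/
def DForm.ι {p : ℕ} (v : VField E M) (α : DForm E M (p + 1)) : DForm E M p := fun x =>
  contractVec (v x) (α x)

/-- The Lie derivative of a form along a vector field, computed in a chart around each point by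
`(L_v α)(w₁, …, w_p) = (D_v α)(w₁, …, w_p) + ∑ i, α(w₁, …, D_{wᵢ} v, …, w_p)`,
which is `v(α(W₁, …, W_p)) - ∑ i, α(W₁, …, [v, Wᵢ], …, W_p)` for the vector fields `Wᵢ` that are
constant in the chart. -/
def DForm.lie {p : ℕ} (v : VField E M) (α : DForm E M p) : DForm E M p := fun x =>
  ofCoordAt x
    (fderiv ℝ (α.coord x) (extChartAt 𝓘(ℝ, E) x x) (v.coord x (extChartAt 𝓘(ℝ, E) x x)) +
      derivAct (fderiv ℝ (v.coord x) (extChartAt 𝓘(ℝ, E) x x))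
        (α.coord x (extChartAt 𝓘(ℝ, E) x x)))

/-! ### Forms of mixed degree -/

/-- The form of mixed degree whose only component is `α`, in degree `p`. -/
def DForm.homog {p : ℕ} (α : DForm E M p) : GForm E M := Pi.single p α

/-- A form of mixed degree is smooth if its components are. -/
def GForm.IsSmooth (α : GForm E M) : Prop := ∀ p, (α p).IsSmooth

/-- The exterior derivative on forms of mixed degree. -/
def GForm.d (α : GForm E M) : GForm E M
  | 0 => 0
  | p + 1 => (α p).d

/-- The interior product on forms of mixed degree. -/
def GForm.ι (v : VField E M) (α : GForm E M) : GForm E M := fun p => (α (p + 1)).ι v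

/-- The Lie derivative on forms of mixed degree. -/
def GForm.lie (v : VField E M) (α : GForm E M) : GForm E M := fun p => (α p).lie v

/-- The iterated contraction `ι(v₁ ∧ … ∧ v_k) = ι_{v_k} ⋯ ι_{v₁}`. -/
def GForm.contract : (k : ℕ) → (Fin k → VField E M) → GForm E M → GForm E M
  | 0, _, α => α
  | k + 1, v, α => GForm.contract k (Fin.tail v) (α.ι (v 0))

/-! ### Algebra of contractions -/

theorem GForm.ι_comm (v w : VField E M) (α : GForm E M) :
    (α.ι v).ι w = -((α.ι w).ι v) := by
  funext p x
  ext u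
  change α (p + 2) x (Fin.cons (v x) (Fin.cons (w x) u))
    = -(α (p + 2) x (Fin.cons (w x) (Fin.cons (v x) u)))
  have h := (α (p + 2) x).toAlternatingMap.map_swap
    (Fin.cons (w x) (Fin.cons (v x) u)) (i := 0) (j := 1) (by simp)
  simp only [ContinuousAlternatingMap.coe_toAlternatingMap] at h
  rw [← h]
  congr 1
  funext j
  refine Fin.cases ?_ (fun j => Fin.cases ?_ (fun j => ?_) j) j
  · simp [Function.comp]
  · simp [Function.comp]
  · rw [Function.comp, Equiv.swap_apply_of_ne_of_ne]
    · rfl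
    · simp
    · simp [Fin.ext_iff]

theorem GForm.ι_neg (v : VField E M) (α : GForm E M) : (-α).ι v = -(α.ι v) := rfl

theorem GForm.ι_zero (v : VField E M) : (0 : GForm E M).ι v = 0 := rfl

theorem GForm.contract_neg (k : ℕ) (v : Fin k → VField E M) (α : GForm E M) :
    GForm.contract k v (-α) = -GForm.contract k v α := by
  induction k generalizing α with
  | zero => rfl
  | succ k ih => simp only [GForm.contract, GForm.ι_neg, ih]

theorem GForm.contract_zero (k : ℕ) (v : Fin k → VField E M) :
    GForm.contract k v (0 : GForm E M) = 0 := by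
  induction k with
  | zero => rfl
  | succ k ih => simp only [GForm.contract, GForm.ι_zero, ih]

theorem GForm.contract_ι (k : ℕ) (v : Fin k → VField E M) (w : VField E M) (α : GForm E M) :
    GForm.contract k v (α.ι w) = (-1 : ℝ) ^ k • (GForm.contract k v α).ι w := by
  induction k generalizing α with
  | zero => simp [GForm.contract]
  | succ k ih =>
    simp only [GForm.contract]
    rw [GForm.ι_comm, GForm.contract_neg, ih, pow_succ, mul_neg_one]
    exact (neg_smul _ _).symm

theorem GForm.contract_congr (k : ℕ) (v v' : Fin k → VField E M) (α : GForm E M)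
    (h : ∀ j, α.ι (v j) = α.ι (v' j)) : GForm.contract k v α = GForm.contract k v' α := by
  induction k generalizing α with
  | zero => rfl
  | succ k ih =>
    simp only [GForm.contract]
    rw [h 0, GForm.contract_ι, GForm.contract_ι, ih (Fin.tail v) (Fin.tail v') α
      fun j => h j.succ]

theorem GForm.contract_eq_zero (k : ℕ) (v : Fin k → VField E M) (α : GForm E M) (j : Fin k)
    (h : α.ι (v j) = 0) : GForm.contract k v α = 0 := by
  induction k generalizing α with
  | zero => exact j.elim0
  | succ k ih =>
    simp only [GForm.contract]
    revert h
    refine Fin.cases (fun h => ?_) (fun i h => ?_) j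
    · rw [h, GForm.contract_zero]
    · refine ih (Fin.tail v) (α.ι (v 0)) i ?_
      rw [GForm.ι_comm]
      change -((α.ι (v i.succ)).ι (v 0)) = 0
      rw [h, GForm.ι_zero, neg_zero]

/-! ### Conserved quantities -/

/-- Locally conserved quantities: smooth forms whose Lie derivative along `v` is closed. -/
def locConserved (v : VField E M) : Set (GForm E M) :=
  {α | α.IsSmooth ∧ (α.lie v).d = 0}

/-- Globally conserved quantities: smooth forms whose Lie derivative along `v` is exact. -/
def globConserved (v : VField E M) : Set (GForm E M) :=
  {α | α.IsSmooth ∧ ∃ γ : GForm E M, γ.IsSmooth ∧ α.lie v = γ.d}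

/-- Strictly conserved quantities: smooth forms whose Lie derivative along `v` vanishes. -/
def strictConserved (v : VField E M) : Set (GForm E M) :=
  {α | α.IsSmooth ∧ α.lie v = 0}

/-! ### Pre-`n`-plectic forms and the Lie `n`-algebra of observables -/

variable [IsManifold 𝓘(ℝ, E) ((⊤ : ℕ∞) : WithTop ℕ∞) M]

/-- A pre-`n`-plectic form: a smooth closed form of degree `n + 1`. -/
def IsPrePlectic {n : ℕ} (ω : DForm E M (n + 1)) : Prop := ω.IsSmooth ∧ ω.d = 0

/-- `v` is a Hamiltonian vector field for the form `α` of degree `n - 1`, i.e. a smooth vector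
field with `dα = -ι_v ω`. -/
def IsHamiltonianField {n : ℕ} (ω : DForm E M (n + 1)) (α : DForm E M (n - 1))
    (v : VField E M) : Prop :=
  v.IsSmooth ∧ α.homog.d = -(ω.homog.ι v)

/-- Hamiltonian forms: smooth `(n - 1)`-forms that admit a Hamiltonian vector field. -/
def IsHamiltonian {n : ℕ} (ω : DForm E M (n + 1)) (α : DForm E M (n - 1)) : Prop :=
  α.IsSmooth ∧ ∃ v : VField E M, IsHamiltonianField ω α v

/-- The graded vector space underlying the Lie `n`-algebra of observables. Its part of degree `i`,
`0 ≤ i ≤ n - 1`, is given by the components in form degree `n - 1 - i`: these are arbitrary smooth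
forms for `i > 0` and Hamiltonian forms for `i = 0`. -/
def observables {n : ℕ} (ω : DForm E M (n + 1)) : Set (GForm E M) :=
  {α | α.IsSmooth ∧ (∀ p, n ≤ p → α p = 0) ∧ IsHamiltonian ω (α (n - 1))}

open Classical in
/-- A choice of a Hamiltonian vector field for a Hamiltonian form `α`. -/
def hamField {n : ℕ} (ω : DForm E M (n + 1)) (α : DForm E M (n - 1)) : VField E M :=
  if h : ∃ v : VField E M, IsHamiltonianField ω α v then h.choose else 0

/-- The sign `ς(k) = -(-1)^{k(k+1)/2}`. -/
def bracketSign (k : ℕ) : ℝ := -(-1) ^ (k * (k + 1) / 2)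

/-- The brackets `l_k`, `k ≥ 1`, of the Lie `n`-algebra of observables, extended multilinearly to
non-homogeneous observables. The bracket `l₁` is the exterior derivative on the part of positive
degree (form degree `< n - 1`) and vanishes on the part of degree `0` (form degree `n - 1`). For
`k ≥ 2` the bracket depends only on the parts `α_j` of degree `0` of the arguments, and is
`ς(k) ι(v_{α₁} ∧ … ∧ v_{α_k}) ω`. By convention `l₀ = 0`. -/
def bracket {n : ℕ} (ω : DForm E M (n + 1)) : (k : ℕ) → (Fin k → GForm E M) → GForm E M
  | 0, _ => 0
  | 1, β => fun p => if p < n then (β 0).d p else 0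
  | k + 2, β => bracketSign (k + 2) •
      GForm.contract (k + 2) (fun j => hamField ω (β j (n - 1))) ω.homog

/-- An `L_∞`-subalgebra of the Lie `n`-algebra of observables: a graded linear subspace that is
closed under all brackets. -/
structure IsLInftySubalgebra {n : ℕ} (ω : DForm E M (n + 1)) (S : Set (GForm E M)) : Prop where
  subset : S ⊆ observables ω
  zero_mem : (0 : GForm E M) ∈ S
  add_mem : ∀ α ∈ S, ∀ β ∈ S, α + β ∈ S
  smul_mem : ∀ c : ℝ, ∀ α ∈ S, c • α ∈ S
  component_mem : ∀ α ∈ S, ∀ p : ℕ, (α p).homog ∈ S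
  bracket_mem : ∀ k : ℕ, 1 ≤ k → ∀ β : Fin k → GForm E M, (∀ j, β j ∈ S) → bracket ω k β ∈ S

/-! ### The brackets do not depend on the choice of Hamiltonian vector fields -/

/-- For `k ≥ 2` the bracket may be computed with any Hamiltonian vector fields. -/
theorem bracket_eq {n : ℕ} (ω : DForm E M (n + 1)) (k : ℕ) (β : Fin (k + 2) → GForm E M)
    (v : Fin (k + 2) → VField E M) (hv : ∀ j, IsHamiltonianField ω (β j (n - 1)) (v j)) :
    bracket ω (k + 2) β = bracketSign (k + 2) • GForm.contract (k + 2) v ω.homog := by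
  simp only [bracket]
  congr 1
  refine GForm.contract_congr _ _ _ _ fun j => ?_
  have hex : ∃ w : VField E M, IsHamiltonianField ω (β j (n - 1)) w := ⟨v j, hv j⟩
  have h1 : IsHamiltonianField ω (β j (n - 1)) (hamField ω (β j (n - 1))) := by
    rw [hamField, dif_pos hex]
    exact hex.choose_spec
  exact neg_injective (h1.2.symm.trans (hv j).2)

/-- For `k ≥ 2` the bracket vanishes if one of its arguments is an observable whose part of
degree `0` is zero, in particular if one of them is homogeneous of positive degree. -/
theorem bracket_eq_zero {n : ℕ} (ω : DForm E M (n + 1)) (k : ℕ) (β : Fin (k + 2) → GForm E M)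
    (hβ : ∀ j, β j ∈ observables ω) (j : Fin (k + 2)) (hj : β j (n - 1) = 0) :
    bracket ω (k + 2) β = 0 := by
  simp only [bracket]
  rw [GForm.contract_eq_zero _ _ _ j, smul_zero]
  have hex := (hβ j).2.2.2
  have h1 : IsHamiltonianField ω (β j (n - 1)) (hamField ω (β j (n - 1))) := by
    rw [hamField, dif_pos hex]
    exact hex.choose_spec
  have h2 := h1.2
  rw [hj] at h2 ⊢
  have h0 : (DForm.homog (0 : DForm E M (n - 1))).d = 0 := by
    have hz : DForm.homog (0 : DForm E M (n - 1)) = 0 := Pi.single_zero _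
    rw [hz]
    funext p
    cases p with
    | zero => rfl
    | succ p =>
      funext x
      have hc : DForm.coord (0 : DForm E M p) x = 0 := rfl
      change ofCoordAt x (extDeriv (DForm.coord (0 : DForm E M p) x) _) = 0
      rw [hc]
      have hd : extDeriv (0 : E → E [⋀^Fin p]→L[ℝ] ℝ) (extChartAt 𝓘(ℝ, E) x x) = 0 := by
        have h := extDeriv_smul (x := extChartAt 𝓘(ℝ, E) x x) (0 : ℝ)
          (0 : E → E [⋀^Fin p]→L[ℝ] ℝ)
        simpa using h
      rw [hd]
      rfl
  rw [h0] at h2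
  exact neg_eq_zero.1 h2.symm

end Manifold

end Multisymplectic

end

/-!
The Lie derivative `ℒ_v` commutes with `d` and satisfies `ℒ_v ι_w = ι_[v,w] + ι_w ℒ_v`. If `β` is a
locally conserved Hamiltonian form with Hamiltonian field `w`, then `ℒ_v ι_w ω = -d ℒ_v β = 0`, and
as `ℒ_v ω = 0` this gives `ι_[v,w] ω = 0`. Hence all iterated contractions of `ω` with such fields
are annihilated by `ℒ_v`, and so is `dβ`: the brackets of locally conserved observables are strictly
conserved. A space of conserved quantities is cut out by requiring `ℒ_v α` to lie in a graded
subspace of the closed forms, so it contains the strictly conserved forms. That brackets of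
observables are observables comes down, by Cartan calculus, to `d ι_w ι_v ω = -ι_[v,w] ω` for
Hamiltonian fields `v` and `w`.
-/

namespace Multisymplectic

section LinearAlgebra

variable {V : Type*} [AddCommGroup V] [Module ℝ V] [TopologicalSpace V] {p : ℕ}

theorem contractVec_compContinuousLinearMap {W : Type*} [AddCommGroup W] [Module ℝ W]
    [TopologicalSpace W] (a : W) (A : W →L[ℝ] V) (f : V [⋀^Fin (p + 1)]→L[ℝ] ℝ) :
    contractVec a (f.compContinuousLinearMap A) =
      (contractVec (A a) f).compContinuousLinearMap A := by
  ext w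
  simp only [contractVec_apply, ContinuousAlternatingMap.compContinuousLinearMap_apply]
  congr 1
  funext j
  cases j using Fin.cases <;> simp

theorem derivAct_add (A : V →L[ℝ] V) (f g : V [⋀^Fin p]→L[ℝ] ℝ) :
    derivAct A (f + g) = derivAct A f + derivAct A g := by
  ext w
  simp [derivAct_apply, Finset.sum_add_distrib]

theorem derivAct_smul (A : V →L[ℝ] V) (c : ℝ) (f : V [⋀^Fin p]→L[ℝ] ℝ) :
    derivAct A (c • f) = c • derivAct A f := by
  ext w
  simp [derivAct_apply, Finset.mul_sum]

theorem derivAct_contractVec (A : V →L[ℝ] V) (a : V) (f : V [⋀^Fin (p + 1)]→L[ℝ] ℝ) :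
    derivAct A (contractVec a f) = contractVec a (derivAct A f) - contractVec (A a) f := by
  ext w
  simp only [derivAct_apply, contractVec_apply, ContinuousAlternatingMap.sub_apply,
    Fin.sum_univ_succ, Fin.cons_zero, Fin.update_cons_zero, Fin.cons_succ, Fin.cons_update]
  ring

end LinearAlgebra

section VectorSpace

open ContinuousAlternatingMap

variable {E : Type*} [NormedAddCommGroup E] [NormedSpace ℝ E] {p : ℕ}

variable (E p) in
/-- Contraction of alternating forms with vectors, as a continuous bilinear map that takes the
form first. -/
noncomputable def contractCLM : (E [⋀^Fin (p + 1)]→L[ℝ] ℝ) →L[ℝ] E →L[ℝ] E [⋀^Fin p]→L[ℝ] ℝ :=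
  curryLeftLI.toContinuousLinearMap

theorem contractVec_sub_left (a b : E) (f : E [⋀^Fin (p + 1)]→L[ℝ] ℝ) :
    contractVec (a - b) f = contractVec a f - contractVec b f :=
  map_sub (contractCLM E p f) a b

theorem contractVec_add (a : E) (f g : E [⋀^Fin (p + 1)]→L[ℝ] ℝ) :
    contractVec a (f + g) = contractVec a f + contractVec a g := rfl

theorem derivAct_eq_alternatizeUncurryFin (A : E →L[ℝ] E) (f : E [⋀^Fin (p + 1)]→L[ℝ] ℝ) :
    derivAct A f = alternatizeUncurryFin (contractCLM E p f ∘L A) := by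
  ext w
  simp only [derivAct_apply, alternatizeUncurryFin_apply, ← Fin.insertNth_removeNth,
    map_insertNth]
  rfl

theorem contractVec_alternatizeUncurryFin (a : E) (B : E →L[ℝ] E [⋀^Fin (p + 1)]→L[ℝ] ℝ) :
    contractVec a (alternatizeUncurryFin B) =
      B a - alternatizeUncurryFin ((contractCLM E p).flip a ∘L B) := by
  ext w
  have removeNth_succ_cons (i : Fin (p + 1)) :
      i.succ.removeNth (Fin.cons a w : Fin (p + 2) → E) = Fin.cons a (i.removeNth w) := by
    funext j
    cases j using Fin.cases <;> simp [Fin.removeNth]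
  rw [contractVec_apply, ContinuousAlternatingMap.sub_apply, alternatizeUncurryFin_apply,
    alternatizeUncurryFin_apply, Fin.sum_univ_succ, sub_eq_add_neg, ← Finset.sum_neg_distrib]
  congr 1
  · simp
  · refine Finset.sum_congr rfl fun i _ => ?_
    rw [removeNth_succ_cons, Fin.cons_succ, Fin.val_succ, pow_succ, mul_neg_one, neg_smul]
    rfl

theorem contDiffOn_contractVec {k : WithTop ℕ∞} {v : E → E} {f : E → E [⋀^Fin (p + 1)]→L[ℝ] ℝ}
    {s : Set E} (hv : ContDiffOn ℝ k v s) (hf : ContDiffOn ℝ k f s) :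
    ContDiffOn ℝ k (fun y => contractVec (v y) (f y)) s :=
  have contDiff_contractCLM : ContDiff ℝ k (contractCLM E p) :=
    ContinuousLinearMap.contDiff _
  (contDiff_contractCLM.comp_contDiffOn hf).clm_apply hv

theorem fderiv_contractVec {v : E → E} {f : E → E [⋀^Fin (p + 1)]→L[ℝ] ℝ} {y : E}
    (hv : DifferentiableAt ℝ v y) (hf : DifferentiableAt ℝ f y) :
    fderiv ℝ (fun z => contractVec (v z) (f z)) y =
      (contractCLM E p).flip (v y) ∘L fderiv ℝ f y + contractCLM E p (f y) ∘L fderiv ℝ v y := by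
  rw [add_comm]
  exact ((contractCLM E p).hasFDerivAt_of_bilinear hf.hasFDerivAt hv.hasFDerivAt).fderiv

/-- The Lie derivative along `v` of a differential form on a vector space, by the formula that
`DForm.lie` uses in charts. -/
noncomputable def lieDeriv (v : E → E) (f : E → E [⋀^Fin p]→L[ℝ] ℝ) (y : E) :
    E [⋀^Fin p]→L[ℝ] ℝ :=
  fderiv ℝ f y (v y) + derivAct (fderiv ℝ v y) (f y)

theorem lieDeriv_add {v : E → E} {f g : E → E [⋀^Fin p]→L[ℝ] ℝ} {y : E}
    (hf : DifferentiableAt ℝ f y) (hg : DifferentiableAt ℝ g y) :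
    lieDeriv v (f + g) y = lieDeriv v f y + lieDeriv v g y := by
  simp only [lieDeriv, fderiv_add hf hg, Pi.add_apply, derivAct_add, _root_.add_apply]
  abel

theorem lieDeriv_const_smul (v : E → E) (c : ℝ) (f : E → E [⋀^Fin p]→L[ℝ] ℝ) (y : E) :
    lieDeriv v (c • f) y = c • lieDeriv v f y := by
  have fderiv_smul : fderiv ℝ (c • f) y = c • fderiv ℝ f y :=
    congrFun (fderiv_const_smul_field (𝕜 := ℝ) (f := f) c) y
  simp only [lieDeriv, fderiv_smul, Pi.smul_apply, derivAct_smul, smul_add, _root_.smul_apply]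

theorem lieDeriv_congr {v : E → E} {f g : E → E [⋀^Fin p]→L[ℝ] ℝ} {y : E} (h : f =ᶠ[𝓝 y] g) :
    lieDeriv v f y = lieDeriv v g y := by
  rw [lieDeriv, lieDeriv, h.fderiv_eq, h.self_of_nhds]

theorem lieDeriv_eq_contractVec_extDeriv (v : E → E) (f : E → E [⋀^Fin 0]→L[ℝ] ℝ) (y : E) :
    lieDeriv v f y = contractVec (v y) (extDeriv f y) := by
  ext w
  simp [lieDeriv, derivAct_apply, contractVec_apply, extDeriv, alternatizeUncurryFin_apply,
    Subsingleton.elim _ w]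

theorem lieDeriv_eq_extDeriv_contractVec_add {v : E → E} {f : E → E [⋀^Fin (p + 1)]→L[ℝ] ℝ}
    {y : E} (hv : DifferentiableAt ℝ v y) (hf : DifferentiableAt ℝ f y) :
    lieDeriv v f y =
      extDeriv (fun z => contractVec (v z) (f z)) y + contractVec (v y) (extDeriv f y) := by
  rw [lieDeriv, extDeriv, extDeriv, contractVec_alternatizeUncurryFin, fderiv_contractVec hv hf,
    alternatizeUncurryFin_add, derivAct_eq_alternatizeUncurryFin]
  abel

theorem lieDeriv_contractVec {v w : E → E} {f : E → E [⋀^Fin (p + 1)]→L[ℝ] ℝ} {y : E}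
    (hw : DifferentiableAt ℝ w y) (hf : DifferentiableAt ℝ f y) :
    lieDeriv v (fun z => contractVec (w z) (f z)) y =
      contractVec (VectorField.lieBracket ℝ v w y) (f y) + contractVec (w y) (lieDeriv v f y) := by
  have fderiv_apply : fderiv ℝ (fun z => contractVec (w z) (f z)) y (v y) =
      contractVec (w y) (fderiv ℝ f y (v y)) + contractVec (fderiv ℝ w y (v y)) (f y) := by
    rw [fderiv_contractVec hw hf]
    rfl
  rw [lieDeriv, lieDeriv, fderiv_apply, derivAct_contractVec, VectorField.lieBracket,
    contractVec_sub_left, contractVec_add]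
  abel

end VectorSpace

section Charts

open scoped ContDiff

variable {E : Type*} [NormedAddCommGroup E] [NormedSpace ℝ E]
  {M : Type*} [TopologicalSpace M] [ChartedSpace E M] {p : ℕ}

local notation "φ" => extChartAt 𝓘(ℝ, E)

variable (E) in
/-- The derivative at `z` of the chart around `x`, as an endomorphism of the model space: the
tangent spaces of the manifold are definitionally the model space. -/
noncomputable def chartDeriv (x z : M) : E →L[ℝ] E :=
  mfderiv 𝓘(ℝ, E) 𝓘(ℝ, E) (φ x) z

variable (E) in
/-- The derivative at `y` of the inverse of the chart around `x`, as an endomorphism of the model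
space. -/
noncomputable def chartSymmDeriv (x : M) (y : E) : E →L[ℝ] E :=
  mfderiv 𝓘(ℝ, E) 𝓘(ℝ, E) (φ x).symm y

theorem DForm.coord_eq_of_symm_eq (α : DForm E M p) {x z : M} {y : E} (h : (φ x).symm y = z) :
    α.coord x y = ContinuousAlternatingMap.compContinuousLinearMap
      (α z : E [⋀^Fin p]→L[ℝ] ℝ) (chartSymmDeriv E x y) := by
  subst h
  rfl

theorem VField.coord_eq_of_symm_eq (v : VField E M) {x z : M} {y : E} (h : (φ x).symm y = z) :
    v.coord x y = chartDeriv E x z (v z) := by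
  subst h
  rfl

theorem DForm.IsSmooth.contDiffAt {α : DForm E M p} (hα : α.IsSmooth) {x : M} {y : E}
    (hy : y ∈ (φ x).target) : ContDiffAt ℝ ∞ (α.coord x) y :=
  (hα x).contDiffAt (extChartAt_target_mem_nhds' hy)

theorem DForm.IsSmooth.differentiableAt {α : DForm E M p} (hα : α.IsSmooth) {x : M} {y : E}
    (hy : y ∈ (φ x).target) : DifferentiableAt ℝ (α.coord x) y :=
  (hα.contDiffAt hy).differentiableAt (by simp)

variable [IsManifold 𝓘(ℝ, E) ((⊤ : ℕ∞) : WithTop ℕ∞) M]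

variable (E M) in
theorem isManifold_one : IsManifold 𝓘(ℝ, E) 1 M := .of_le (n := ∞) (by norm_cast)

theorem chartDeriv_self (x : M) : chartDeriv E x x = ContinuousLinearMap.id ℝ E :=
  have := isManifold_one E M
  mfderiv_extChartAt_self

theorem chartSymmDeriv_comp_chartDeriv_symm {x : M} {y : E} (hy : y ∈ (φ x).target) :
    chartSymmDeriv E x y ∘L chartDeriv E x ((φ x).symm y) = ContinuousLinearMap.id ℝ E := by
  have := isManifold_one E M
  have h := mfderivWithin_extChartAt_symm_comp_mfderiv_extChartAt hy
  simp only [modelWithCornersSelf_coe, Set.range_id, mfderivWithin_univ] at h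
  exact h

theorem chartSymmDeriv_comp_chartDeriv {x z : M} (hz : z ∈ (φ x).source) :
    chartSymmDeriv E x (φ x z) ∘L chartDeriv E x z = ContinuousLinearMap.id ℝ E := by
  have h := chartSymmDeriv_comp_chartDeriv_symm ((φ x).map_source hz)
  rwa [(φ x).left_inv hz] at h

theorem chartSymmDeriv_self (x : M) :
    chartSymmDeriv E x (φ x x) = ContinuousLinearMap.id ℝ E := by
  simpa [chartDeriv_self] using
    chartSymmDeriv_comp_chartDeriv (mem_extChartAt_source (I := 𝓘(ℝ, E)) x)

theorem ofCoordAt_eq (x : M) (f : E [⋀^Fin p]→L[ℝ] ℝ) : ofCoordAt x f = f := by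
  change f.compContinuousLinearMap (chartDeriv E x x) = f
  rw [chartDeriv_self]
  rfl

theorem DForm.d_apply (α : DForm E M p) (x : M) : α.d x = extDeriv (α.coord x) (φ x x) :=
  ofCoordAt_eq x _

theorem DForm.lie_apply (v : VField E M) (α : DForm E M p) (x : M) :
    α.lie v x = lieDeriv (v.coord x) (α.coord x) (φ x x) :=
  ofCoordAt_eq x _

theorem DForm.coord_extChartAt_self (α : DForm E M p) (x : M) : α.coord x (φ x x) = α x := by
  rw [α.coord_eq_of_symm_eq (extChartAt_to_inv x), chartSymmDeriv_self]
  rfl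

theorem VField.coord_extChartAt_self (v : VField E M) (x : M) : v.coord x (φ x x) = v x := by
  rw [v.coord_eq_of_symm_eq (extChartAt_to_inv x), chartDeriv_self]
  rfl

theorem DForm.coord_ι (v : VField E M) (α : DForm E M (p + 1)) {x : M} {y : E}
    (hy : y ∈ (φ x).target) :
    (α.ι v).coord x y = contractVec (v.coord x y) (α.coord x y) := by
  have symm_coord : chartSymmDeriv E x y (v.coord x y) = v ((φ x).symm y) :=
    congrArg (fun A : E →L[ℝ] E => A (v ((φ x).symm y))) (chartSymmDeriv_comp_chartDeriv_symm hy)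
  have coord_eq : (α.ι v).coord x y =
      ContinuousAlternatingMap.compContinuousLinearMap
        (contractVec (V := E) (v ((φ x).symm y)) (α ((φ x).symm y))) (chartSymmDeriv E x y) := rfl
  rw [coord_eq, ← symm_coord]
  exact (contractVec_compContinuousLinearMap (V := E) (W := E) _ _ _).symm

theorem DForm.coord_ι_eventuallyEq (v : VField E M) (α : DForm E M (p + 1)) (x : M) :
    (α.ι v).coord x =ᶠ[𝓝 (φ x x)] fun y => contractVec (v.coord x y) (α.coord x y) := by
  filter_upwards [extChartAt_target_mem_nhds x] with y hy using DForm.coord_ι v α hy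

theorem contDiffAt_extChartAt_comp_symm {x z : M} {y : E} (hy : y ∈ (φ x).target)
    (hyz : (φ x).symm y ∈ (φ z).source) : ContDiffAt ℝ ∞ (φ z ∘ (φ x).symm) y := by
  rw [← contMDiffAt_iff_contDiffAt]
  exact (contMDiffAt_extChartAt' (by simpa using hyz)).comp y
    ((contMDiffOn_extChartAt_symm x).contMDiffAt (extChartAt_target_mem_nhds' hy))

theorem fderiv_extChartAt_comp_symm {x z : M} {y : E} (hy : y ∈ (φ x).target)
    (hyz : (φ x).symm y ∈ (φ z).source) :
    fderiv ℝ (φ z ∘ (φ x).symm) y = chartDeriv E z ((φ x).symm y) ∘L chartSymmDeriv E x y := by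
  have := isManifold_one E M
  have mdifferentiableAt_symm : MDifferentiableAt 𝓘(ℝ, E) 𝓘(ℝ, E) (φ x).symm y := by
    simpa [mdifferentiableWithinAt_univ] using mdifferentiableWithinAt_extChartAt_symm hy
  have mdifferentiableAt_chart : MDifferentiableAt 𝓘(ℝ, E) 𝓘(ℝ, E) (φ z) ((φ x).symm y) :=
    mdifferentiableAt_extChartAt (by simpa using hyz)
  rw [← mfderiv_eq_fderiv]
  exact mfderiv_comp y mdifferentiableAt_chart mdifferentiableAt_symm

theorem DForm.coord_eq_pullback (α : DForm E M p) {x z : M} {y : E} (hy : y ∈ (φ x).target)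
    (hyz : (φ x).symm y ∈ (φ z).source) :
    α.coord x y = (α.coord z (φ z ((φ x).symm y))).compContinuousLinearMap
      (fderiv ℝ (φ z ∘ (φ x).symm) y) := by
  have cancel : chartSymmDeriv E z (φ z ((φ x).symm y)) ∘L fderiv ℝ (φ z ∘ (φ x).symm) y =
      chartSymmDeriv E x y := by
    rw [fderiv_extChartAt_comp_symm hy hyz, ← ContinuousLinearMap.comp_assoc,
      chartSymmDeriv_comp_chartDeriv hyz, ContinuousLinearMap.id_comp]
  rw [α.coord_eq_of_symm_eq rfl, α.coord_eq_of_symm_eq ((φ z).left_inv hyz), ← cancel]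
  rfl

theorem minSmoothness_two_le_infty : minSmoothness ℝ 2 ≤ ∞ := by
  rw [minSmoothness_of_isRCLikeNormedField]
  exact WithTop.coe_le_coe.2 (le_top : (2 : ℕ∞) ≤ ⊤)

theorem DForm.coord_d {α : DForm E M p} (hα : α.IsSmooth) {x : M} {y : E}
    (hy : y ∈ (φ x).target) : α.d.coord x y = extDeriv (α.coord x) y := by
  set z := (φ x).symm y
  have mem_source : (φ x).symm y ∈ (φ z).source := mem_extChartAt_source z
  have coord_eventuallyEq : α.coord x =ᶠ[𝓝 y] fun y' =>
      (α.coord z ((φ z ∘ (φ x).symm) y')).compContinuousLinearMap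
        (fderiv ℝ (φ z ∘ (φ x).symm) y') := by
    filter_upwards [extChartAt_target_mem_nhds' hy,
      (continuousAt_extChartAt_symm'' hy).preimage_mem_nhds
        (extChartAt_source_mem_nhds (I := 𝓘(ℝ, E)) z)] with y' hy' hyz'
    using α.coord_eq_pullback hy' hyz'
  rw [coord_eventuallyEq.extDeriv_eq, extDeriv_pullback (r := ∞) (f := φ z ∘ (φ x).symm)
    (hα.differentiableAt ((φ z).map_source mem_source))
    (contDiffAt_extChartAt_comp_symm hy mem_source) minSmoothness_two_le_infty,
    fderiv_extChartAt_comp_symm hy mem_source]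
  rfl

theorem DForm.IsSmooth.d {α : DForm E M p} (hα : α.IsSmooth) : α.d.IsSmooth := by
  intro x
  have contDiffOn_fderiv : ContDiffOn ℝ ∞ (fderiv ℝ (α.coord x)) (φ x).target :=
    (hα x).fderiv_of_isOpen (isOpen_extChartAt_target x) (by norm_cast)
  have contDiff_alternatize : ContDiff ℝ ∞
      (ContinuousAlternatingMap.alternatizeUncurryFinCLM ℝ E ℝ (n := p)) :=
    ContinuousLinearMap.contDiff _
  exact (contDiff_alternatize.comp_contDiffOn contDiffOn_fderiv).congr fun y hy =>
    DForm.coord_d hα hy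

theorem DForm.d_d {α : DForm E M p} (hα : α.IsSmooth) : α.d.d = 0 := by
  funext x
  have coord_d_eventuallyEq : α.d.coord x =ᶠ[𝓝 (φ x x)] extDeriv (α.coord x) := by
    filter_upwards [extChartAt_target_mem_nhds x] with y hy using DForm.coord_d hα hy
  rw [DForm.d_apply, coord_d_eventuallyEq.extDeriv_eq,
    extDeriv_extDeriv_apply (hα.contDiffAt (mem_extChartAt_target x)) minSmoothness_two_le_infty]
  rfl

theorem VField.IsSmooth.contDiffOn_coord {v : VField E M} (hv : v.IsSmooth) (x : M) :
    ContDiffOn ℝ ∞ (v.coord x) (φ x).target := by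
  have := isManifold_one E M
  let e := trivializationAt E (TangentSpace 𝓘(ℝ, E)) x
  have contMDiffOn_section :=
    (e.contMDiffOn_section_baseSet_iff (IB := 𝓘(ℝ, E)) (n := ∞)).1 hv.contMDiffOn
  have coord_eq {y : E} (hy : y ∈ (φ x).target) :
      v.coord x y = (e ⟨(φ x).symm y, v ((φ x).symm y)⟩).2 := by
    have mem_source : (φ x).symm y ∈ (chartAt E x).source := by
      simpa using (φ x).map_target hy
    have mem_baseSet : (φ x).symm y ∈ e.baseSet := by simpa [e] using mem_source
    rw [v.coord_eq_of_symm_eq rfl, chartDeriv,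
      ← TangentBundle.continuousLinearMapAt_trivializationAt (I := 𝓘(ℝ, E)) mem_source]
    exact congrFun (e.coe_linearMapAt_of_mem (R := ℝ) mem_baseSet) _
  rw [← contMDiffOn_iff_contDiffOn]
  refine (contMDiffOn_section.comp (contMDiffOn_extChartAt_symm x) fun y hy => ?_).congr
    fun y hy => coord_eq hy
  simpa [e] using (φ x).map_target hy

theorem VField.IsSmooth.differentiableAt {v : VField E M} (hv : v.IsSmooth) {x : M} {y : E}
    (hy : y ∈ (φ x).target) : DifferentiableAt ℝ (v.coord x) y :=
  ((hv.contDiffOn_coord x).contDiffAt (extChartAt_target_mem_nhds' hy)).differentiableAt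
    (by simp)

theorem DForm.IsSmooth.ι {α : DForm E M (p + 1)} (hα : α.IsSmooth) {v : VField E M}
    (hv : v.IsSmooth) : (α.ι v).IsSmooth := fun x =>
  (contDiffOn_contractVec (hv.contDiffOn_coord x) (hα x)).congr fun _ hy => DForm.coord_ι v α hy

theorem DForm.lie_eq_d_ι_add_ι_d {α : DForm E M (p + 1)} (hα : α.IsSmooth) {v : VField E M}
    (hv : v.IsSmooth) : α.lie v = (α.ι v).d + α.d.ι v := by
  funext x
  have hx := mem_extChartAt_target (I := 𝓘(ℝ, E)) x
  rw [DForm.lie_apply, lieDeriv_eq_extDeriv_contractVec_add (hv.differentiableAt hx)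
    (hα.differentiableAt hx), ← (DForm.coord_ι_eventuallyEq v α x).extDeriv_eq,
    v.coord_extChartAt_self, ← DForm.d_apply, ← DForm.d_apply]
  rfl

theorem DForm.lie_eq_ι_d (v : VField E M) (α : DForm E M 0) : α.lie v = α.d.ι v := by
  funext x
  rw [DForm.lie_apply, lieDeriv_eq_contractVec_extDeriv, v.coord_extChartAt_self,
    ← DForm.d_apply]
  rfl

theorem mlieBracket_eq_lieBracket_coord (v w : VField E M) (x : M) :
    VectorField.mlieBracket 𝓘(ℝ, E) v w x =
      VectorField.lieBracket ℝ (v.coord x) (w.coord x) (φ x x) := by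
  have := isManifold_one E M
  let pullback (u : VField E M) : E → E :=
    VectorField.mpullbackWithin 𝓘(ℝ, E) 𝓘(ℝ, E) (φ x).symm u (Set.range 𝓘(ℝ, E))
  have pullback_eventuallyEq (u : VField E M) : pullback u =ᶠ[𝓝 (φ x x)] u.coord x := by
    filter_upwards [extChartAt_target_mem_nhds x] with y hy
    change VectorField.mpullbackWithin _ _ _ _ _ _ = _
    rw [VectorField.mpullbackWithin_apply, ContinuousLinearMap.inverse_eq
      (mfderivWithin_extChartAt_symm_comp_mfderiv_extChartAt hy)
      (mfderiv_extChartAt_comp_mfderivWithin_extChartAt_symm hy)]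
    rfl
  have h_univ : (φ x).symm ⁻¹' Set.univ ∩ Set.range 𝓘(ℝ, E) = Set.univ := by simp
  have h : VectorField.mlieBracket 𝓘(ℝ, E) v w x =
      (chartDeriv E x x).inverse (VectorField.lieBracket ℝ (v.coord x) (w.coord x) (φ x x)) := by
    rw [← (pullback_eventuallyEq v).lieBracket_vectorField_eq (pullback_eventuallyEq w),
      ← VectorField.lieBracketWithin_univ, ← h_univ]
    rfl
  rw [h, chartDeriv_self, ContinuousLinearMap.inverse_id]
  rfl

theorem DForm.lie_ι {α : DForm E M (p + 1)} (hα : α.IsSmooth) (v : VField E M) {w : VField E M}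
    (hw : w.IsSmooth) :
    (α.ι w).lie v = α.ι (VectorField.mlieBracket 𝓘(ℝ, E) v w) + (α.lie v).ι w := by
  funext x
  have hx := mem_extChartAt_target (I := 𝓘(ℝ, E)) x
  rw [DForm.lie_apply, lieDeriv_congr (DForm.coord_ι_eventuallyEq w α x),
    lieDeriv_contractVec (hw.differentiableAt hx) (hα.differentiableAt hx),
    ← mlieBracket_eq_lieBracket_coord, w.coord_extChartAt_self, α.coord_extChartAt_self,
    ← DForm.lie_apply]
  rfl

theorem VField.IsSmooth.mlieBracket [CompleteSpace E] {v w : VField E M} (hv : v.IsSmooth)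
    (hw : w.IsSmooth) : VField.IsSmooth (VectorField.mlieBracket 𝓘(ℝ, E) v w) := by
  have : IsManifold 𝓘(ℝ, E) (minSmoothness ℝ 2) M := .of_le minSmoothness_two_le_infty
  have : IsManifold 𝓘(ℝ, E) (∞ + 1) M := by
    rw [show (∞ : WithTop ℕ∞) + 1 = ∞ from rfl]
    infer_instance
  exact ContDiff.mlieBracket_vectorField (m := ⊤) (n := ⊤) hv hw (by simp)

end Charts

section Forms

variable {E : Type*} [NormedAddCommGroup E] [NormedSpace ℝ E]
  {M : Type*} [TopologicalSpace M] [ChartedSpace E M] {p : ℕ}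

theorem DForm.IsSmooth.zero : (0 : DForm E M p).IsSmooth := fun _ =>
  (contDiffOn_const : ContDiffOn ℝ _ (fun _ : E => (0 : E [⋀^Fin p]→L[ℝ] ℝ)) _)

theorem DForm.IsSmooth.add {α β : DForm E M p} (hα : α.IsSmooth) (hβ : β.IsSmooth) :
    (α + β).IsSmooth := fun x => (hα x).add (hβ x)

theorem DForm.IsSmooth.smul (c : ℝ) {α : DForm E M p} (hα : α.IsSmooth) :
    (c • α).IsSmooth := fun x => (hα x).const_smul c

theorem DForm.d_add {α β : DForm E M p} (hα : α.IsSmooth) (hβ : β.IsSmooth) :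
    (α + β).d = α.d + β.d := by
  funext x
  have hx := mem_extChartAt_target (I := 𝓘(ℝ, E)) x
  change ofCoordAt x (extDeriv (α.coord x + β.coord x) _) = _
  rw [extDeriv_add (hα.differentiableAt hx) (hβ.differentiableAt hx)]
  rfl

theorem DForm.d_smul (c : ℝ) (α : DForm E M p) : (c • α).d = c • α.d := by
  funext x
  change ofCoordAt x (extDeriv (c • α.coord x) _) = _
  rw [extDeriv_smul]
  rfl

theorem DForm.d_zero : (0 : DForm E M p).d = 0 := by
  simpa using DForm.d_smul 0 (0 : DForm E M p)

theorem DForm.lie_add (v : VField E M) {α β : DForm E M p} (hα : α.IsSmooth)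
    (hβ : β.IsSmooth) : (α + β).lie v = α.lie v + β.lie v := by
  funext x
  have hx := mem_extChartAt_target (I := 𝓘(ℝ, E)) x
  change ofCoordAt x (lieDeriv (v.coord x) (α.coord x + β.coord x) _) = _
  rw [lieDeriv_add (hα.differentiableAt hx) (hβ.differentiableAt hx)]
  rfl

theorem DForm.lie_smul (v : VField E M) (c : ℝ) (α : DForm E M p) :
    (c • α).lie v = c • α.lie v := by
  funext x
  change ofCoordAt x (lieDeriv (v.coord x) (c • α.coord x) _) = _
  rw [lieDeriv_const_smul]
  rfl

theorem DForm.lie_zero (v : VField E M) : (0 : DForm E M p).lie v = 0 := by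
  simpa using DForm.lie_smul v 0 (0 : DForm E M p)

theorem DForm.homog_self (α : DForm E M p) : α.homog p = α := Pi.single_eq_same p α

theorem DForm.homog_of_ne {q : ℕ} (α : DForm E M p) (h : q ≠ p) : α.homog q = 0 :=
  Pi.single_eq_of_ne h α

theorem DForm.homog_zero : (0 : DForm E M p).homog = 0 := Pi.single_zero p

theorem DForm.homog_add (α β : DForm E M p) : (α + β).homog = α.homog + β.homog :=
  Pi.single_add p α β

theorem DForm.homog_smul (c : ℝ) (α : DForm E M p) : (c • α).homog = c • α.homog :=
  Pi.single_smul p c α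

theorem DForm.IsSmooth.homog {α : DForm E M p} (hα : α.IsSmooth) : α.homog.IsSmooth := by
  intro q
  obtain rfl | h := eq_or_ne q p
  · rwa [DForm.homog_self]
  · rw [DForm.homog_of_ne _ h]
    exact .zero

theorem DForm.d_homog (α : DForm E M p) : α.homog.d = α.d.homog := by
  funext q
  cases q with
  | zero => exact (DForm.homog_of_ne _ p.succ_ne_zero.symm).symm
  | succ q =>
    change (α.homog q).d = _
    obtain rfl | h := eq_or_ne q p
    · rw [DForm.homog_self, DForm.homog_self]
    · rw [DForm.homog_of_ne _ h, DForm.homog_of_ne _ (by simpa using h), DForm.d_zero]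

theorem DForm.lie_homog (v : VField E M) (α : DForm E M p) :
    α.homog.lie v = (α.lie v).homog := by
  funext q
  change (α.homog q).lie v = _
  obtain rfl | h := eq_or_ne q p
  · rw [DForm.homog_self, DForm.homog_self]
  · rw [DForm.homog_of_ne _ h, DForm.homog_of_ne _ h, DForm.lie_zero]

theorem GForm.homog_component {α : GForm E M} (h : ∀ q, q ≠ p → α q = 0) :
    (α p).homog = α := by
  funext q
  obtain rfl | hq := eq_or_ne q p
  · exact DForm.homog_self _
  · rw [DForm.homog_of_ne _ hq, h q hq]

theorem GForm.IsSmooth.zero : (0 : GForm E M).IsSmooth := fun _ => .zero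

theorem GForm.IsSmooth.add {α β : GForm E M} (hα : α.IsSmooth) (hβ : β.IsSmooth) :
    (α + β).IsSmooth := fun p => (hα p).add (hβ p)

theorem GForm.IsSmooth.smul (c : ℝ) {α : GForm E M} (hα : α.IsSmooth) : (c • α).IsSmooth :=
  fun p => (hα p).smul c

theorem GForm.d_add {α β : GForm E M} (hα : α.IsSmooth) (hβ : β.IsSmooth) :
    (α + β).d = α.d + β.d := by
  funext p
  cases p with
  | zero => exact (add_zero _).symm
  | succ p => exact DForm.d_add (hα p) (hβ p)

theorem GForm.d_smul (c : ℝ) (α : GForm E M) : (c • α).d = c • α.d := by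
  funext p
  cases p with
  | zero => exact (smul_zero c).symm
  | succ p => exact DForm.d_smul c (α p)

theorem GForm.d_zero : (0 : GForm E M).d = 0 := by
  simpa using GForm.d_smul 0 (0 : GForm E M)

theorem GForm.d_neg (α : GForm E M) : (-α).d = -α.d := by
  rw [← neg_one_smul ℝ α, GForm.d_smul]
  exact neg_one_smul ℝ α.d

theorem GForm.lie_add (v : VField E M) {α β : GForm E M} (hα : α.IsSmooth) (hβ : β.IsSmooth) :
    (α + β).lie v = α.lie v + β.lie v :=
  funext fun p => DForm.lie_add v (hα p) (hβ p)

theorem GForm.lie_smul (v : VField E M) (c : ℝ) (α : GForm E M) : (c • α).lie v = c • α.lie v :=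
  funext fun p => DForm.lie_smul v c (α p)

theorem GForm.lie_zero (v : VField E M) : (0 : GForm E M).lie v = 0 :=
  funext fun _ => DForm.lie_zero v

theorem GForm.lie_neg (v : VField E M) (α : GForm E M) : (-α).lie v = -α.lie v := by
  rw [← neg_one_smul ℝ α, GForm.lie_smul]
  exact neg_one_smul ℝ (α.lie v)

theorem GForm.ι_zero_left (α : GForm E M) : α.ι 0 = 0 := by
  funext p x
  exact map_zero (contractCLM E p (α (p + 1) x))

theorem GForm.ι_add_left (v w : VField E M) (α : GForm E M) : α.ι (v + w) = α.ι v + α.ι w := by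
  funext p x
  exact map_add (contractCLM E p (α (p + 1) x)) (v x) (w x)

theorem GForm.ι_smul_left (c : ℝ) (v : VField E M) (α : GForm E M) :
    α.ι (c • v) = c • α.ι v := by
  funext p x
  exact map_smul (contractCLM E p (α (p + 1) x)) c (v x)

theorem GForm.ι_neg_left (v : VField E M) (α : GForm E M) : α.ι (-v) = -α.ι v := by
  funext p x
  exact map_neg (contractCLM E p (α (p + 1) x)) (v x)

theorem GForm.contract_apply_eq_zero {k : ℕ} (v : Fin k → VField E M) {α : GForm E M}
    (h : α (p + k) = 0) : GForm.contract k v α p = 0 := by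
  induction k generalizing α with
  | zero => exact h
  | succ k ih =>
    refine ih _ ?_
    change (α (p + (k + 1))).ι (v 0) = 0
    rw [h]
    rfl

variable [IsManifold 𝓘(ℝ, E) ((⊤ : ℕ∞) : WithTop ℕ∞) M]

theorem VField.IsSmooth.zero : (0 : VField E M).IsSmooth :=
  Bundle.contMDiff_zeroSection ℝ (TangentSpace 𝓘(ℝ, E) : M → Type _)

theorem VField.IsSmooth.add {v w : VField E M} (hv : v.IsSmooth) (hw : w.IsSmooth) :
    (v + w).IsSmooth := ContMDiff.add_section hv hw

theorem VField.IsSmooth.smul (c : ℝ) {v : VField E M} (hv : v.IsSmooth) : (c • v).IsSmooth :=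
  ContMDiff.const_smul_section hv

theorem GForm.IsSmooth.d {α : GForm E M} (hα : α.IsSmooth) : α.d.IsSmooth
  | 0 => .zero
  | p + 1 => (hα p).d

theorem GForm.d_d {α : GForm E M} (hα : α.IsSmooth) : α.d.d = 0 := by
  funext p
  match p with
  | 0 => rfl
  | 1 => exact DForm.d_zero
  | p + 2 => exact DForm.d_d (hα p)

theorem GForm.IsSmooth.ι {α : GForm E M} (hα : α.IsSmooth) {v : VField E M} (hv : v.IsSmooth) :
    (α.ι v).IsSmooth := fun p => (hα (p + 1)).ι hv

theorem GForm.IsSmooth.contract {k : ℕ} {v : Fin k → VField E M} (hv : ∀ j, (v j).IsSmooth)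
    {α : GForm E M} (hα : α.IsSmooth) : (GForm.contract k v α).IsSmooth := by
  induction k generalizing α with
  | zero => exact hα
  | succ k ih => exact ih (fun j => hv j.succ) (hα.ι (hv 0))

theorem GForm.lie_eq_d_ι_add_ι_d {α : GForm E M} (hα : α.IsSmooth) {v : VField E M}
    (hv : v.IsSmooth) : α.lie v = (α.ι v).d + α.d.ι v := by
  funext p
  cases p with
  | zero => exact (DForm.lie_eq_ι_d v (α 0)).trans (zero_add _).symm
  | succ p => exact DForm.lie_eq_d_ι_add_ι_d (hα (p + 1)) hv

theorem GForm.IsSmooth.lie {α : GForm E M} (hα : α.IsSmooth) {v : VField E M} (hv : v.IsSmooth) :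
    (α.lie v).IsSmooth := by
  rw [GForm.lie_eq_d_ι_add_ι_d hα hv]
  exact (hα.ι hv).d.add (hα.d.ι hv)

theorem GForm.lie_d {α : GForm E M} (hα : α.IsSmooth) {v : VField E M} (hv : v.IsSmooth) :
    α.d.lie v = (α.lie v).d := by
  rw [GForm.lie_eq_d_ι_add_ι_d hα.d hv, GForm.lie_eq_d_ι_add_ι_d hα hv,
    GForm.d_add (hα.ι hv).d (hα.d.ι hv), GForm.d_d (hα.ι hv), GForm.d_d hα, GForm.ι_zero,
    add_zero, zero_add]

theorem GForm.lie_ι {α : GForm E M} (hα : α.IsSmooth) (v : VField E M) {w : VField E M}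
    (hw : w.IsSmooth) :
    (α.ι w).lie v = α.ι (VectorField.mlieBracket 𝓘(ℝ, E) v w) + (α.lie v).ι w :=
  funext fun p => DForm.lie_ι (hα (p + 1)) v hw

theorem GForm.ι_mlieBracket_eq_zero {α : GForm E M} (hα : α.IsSmooth) {v w : VField E M}
    (hw : w.IsSmooth) (hvα : α.lie v = 0) (hvw : (α.ι w).lie v = 0) :
    α.ι (VectorField.mlieBracket 𝓘(ℝ, E) v w) = 0 := by
  rw [← hvw, GForm.lie_ι hα v hw, hvα, GForm.ι_zero, add_zero]

theorem GForm.lie_contract_eq_zero {k : ℕ} {v : VField E M} {w : Fin k → VField E M}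
    (hw : ∀ j, (w j).IsSmooth) {α : GForm E M} (hα : α.IsSmooth) (hvα : α.lie v = 0)
    (hvw : ∀ j, (α.ι (w j)).lie v = 0) : (GForm.contract k w α).lie v = 0 := by
  induction k generalizing α with
  | zero => exact hvα
  | succ k ih =>
    refine ih (fun j => hw j.succ) (hα.ι (hw 0)) (hvw 0) fun j => ?_
    have ι_bracket : (α.ι (w 0)).ι (VectorField.mlieBracket 𝓘(ℝ, E) v (w j.succ)) = 0 := by
      rw [GForm.ι_comm, GForm.ι_mlieBracket_eq_zero hα (hw _) hvα (hvw _), GForm.ι_zero, neg_zero]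
    calc ((α.ι (w 0)).ι (w j.succ)).lie v
        = (α.ι (w 0)).ι (VectorField.mlieBracket 𝓘(ℝ, E) v (w j.succ)) +
            ((α.ι (w 0)).lie v).ι (w j.succ) := GForm.lie_ι (hα.ι (hw 0)) v (hw _)
      _ = 0 := by rw [ι_bracket, hvw, GForm.ι_zero, add_zero]

theorem GForm.d_ι_ι {α : GForm E M} (hα : α.IsSmooth) (hdα : α.d = 0) {v w : VField E M}
    (hv : v.IsSmooth) (hw : w.IsSmooth) (hvα : (α.ι v).d = 0) (hwα : (α.ι w).d = 0) :
    ((α.ι v).ι w).d = α.ι (VectorField.mlieBracket 𝓘(ℝ, E) w v) := by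
  have lie_eq_zero : α.lie w = 0 := by
    rw [GForm.lie_eq_d_ι_add_ι_d hα hw, hwα, hdα, GForm.ι_zero, add_zero]
  calc ((α.ι v).ι w).d
      = (α.ι v).lie w := by
        rw [GForm.lie_eq_d_ι_add_ι_d (hα.ι hv) hw, hvα, GForm.ι_zero, add_zero]
    _ = α.ι (VectorField.mlieBracket 𝓘(ℝ, E) w v) := by
        rw [GForm.lie_ι hα w hv, lie_eq_zero, GForm.ι_zero, add_zero]

end Forms

section GradedSubspaces

variable {E : Type*} [NormedAddCommGroup E] [NormedSpace ℝ E]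
  {M : Type*} [TopologicalSpace M] [ChartedSpace E M]

/-- Graded linear subspaces of the space of forms of mixed degree: linear subspaces that contain
the homogeneous components of their elements. -/
structure IsGradedSubspace (S : Set (GForm E M)) : Prop where
  zero_mem : (0 : GForm E M) ∈ S
  add_mem : ∀ α ∈ S, ∀ β ∈ S, α + β ∈ S
  smul_mem : ∀ c : ℝ, ∀ α ∈ S, c • α ∈ S
  component_mem : ∀ α ∈ S, ∀ p : ℕ, (α p).homog ∈ S

theorem IsGradedSubspace.inter {S T : Set (GForm E M)} (hS : IsGradedSubspace S)
    (hT : IsGradedSubspace T) : IsGradedSubspace (S ∩ T) where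
  zero_mem := ⟨hS.zero_mem, hT.zero_mem⟩
  add_mem α hα β hβ := ⟨hS.add_mem α hα.1 β hβ.1, hT.add_mem α hα.2 β hβ.2⟩
  smul_mem c α hα := ⟨hS.smul_mem c α hα.1, hT.smul_mem c α hα.2⟩
  component_mem α hα p := ⟨hS.component_mem α hα.1 p, hT.component_mem α hα.2 p⟩

variable (E M) in
/-- The smooth closed forms of mixed degree. -/
def closedForms : Set (GForm E M) :=
  {α | α.IsSmooth ∧ α.d = 0}

variable (E M) in
/-- The exact forms of mixed degree, with a smooth primitive. -/
def exactForms : Set (GForm E M) :=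
  {α | ∃ γ : GForm E M, γ.IsSmooth ∧ α = γ.d}

/-- The smooth forms whose Lie derivative along `v` lies in `T`. The locally, globally and strictly
conserved quantities are the cases where `T` consists of the closed forms, the exact forms and `0`
respectively. -/
def conserved (v : VField E M) (T : Set (GForm E M)) : Set (GForm E M) :=
  {α | α.IsSmooth ∧ α.lie v ∈ T}

theorem globConserved_eq_conserved (v : VField E M) :
    globConserved v = conserved v (exactForms E M) := rfl

theorem strictConserved_eq_conserved (v : VField E M) : strictConserved v = conserved v {0} := rfl

theorem isGradedSubspace_closedForms : IsGradedSubspace (closedForms E M) where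
  zero_mem := ⟨.zero, GForm.d_zero⟩
  add_mem _ hα _ hβ :=
    ⟨hα.1.add hβ.1, by rw [GForm.d_add hα.1 hβ.1, hα.2, hβ.2, add_zero]⟩
  smul_mem c _ hα := ⟨hα.1.smul c, by rw [GForm.d_smul, hα.2, smul_zero]⟩
  component_mem α hα p := by
    have d_component : (α p).d = 0 := congrFun hα.2 (p + 1)
    exact ⟨(hα.1 p).homog, by rw [DForm.d_homog, d_component, DForm.homog_zero]⟩

theorem isGradedSubspace_exactForms : IsGradedSubspace (exactForms E M) where
  zero_mem := ⟨0, .zero, GForm.d_zero.symm⟩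
  add_mem := by
    rintro _ ⟨γ, hγ, rfl⟩ _ ⟨δ, hδ, rfl⟩
    exact ⟨γ + δ, hγ.add hδ, (GForm.d_add hγ hδ).symm⟩
  smul_mem := by
    rintro c _ ⟨γ, hγ, rfl⟩
    exact ⟨c • γ, hγ.smul c, (GForm.d_smul c γ).symm⟩
  component_mem := by
    rintro _ ⟨γ, hγ, rfl⟩ (_ | p)
    · exact ⟨0, .zero, DForm.homog_zero.trans GForm.d_zero.symm⟩
    · exact ⟨(γ p).homog, (hγ p).homog, (DForm.d_homog (γ p)).symm⟩

theorem isGradedSubspace_singleton_zero : IsGradedSubspace ({0} : Set (GForm E M)) where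
  zero_mem := rfl
  add_mem := by
    rintro _ rfl _ rfl
    exact add_zero _
  smul_mem := by
    rintro c _ rfl
    exact smul_zero c
  component_mem := by
    rintro _ rfl p
    exact DForm.homog_zero

theorem IsGradedSubspace.conserved {T : Set (GForm E M)} (hT : IsGradedSubspace T)
    (v : VField E M) : IsGradedSubspace (conserved v T) where
  zero_mem := ⟨.zero, (GForm.lie_zero v).symm ▸ hT.zero_mem⟩
  add_mem _ hα _ hβ :=
    ⟨hα.1.add hβ.1, (GForm.lie_add v hα.1 hβ.1).symm ▸ hT.add_mem _ hα.2 _ hβ.2⟩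
  smul_mem c α hα := ⟨hα.1.smul c, (GForm.lie_smul v c α).symm ▸ hT.smul_mem c _ hα.2⟩
  component_mem α hα p :=
    ⟨(hα.1 p).homog, (DForm.lie_homog v (α p)).symm ▸ hT.component_mem _ hα.2 p⟩

variable [IsManifold 𝓘(ℝ, E) ((⊤ : ℕ∞) : WithTop ℕ∞) M]

theorem exactForms_subset_closedForms : exactForms E M ⊆ closedForms E M := by
  rintro _ ⟨γ, hγ, rfl⟩
  exact ⟨hγ.d, GForm.d_d hγ⟩

theorem locConserved_eq_conserved {v : VField E M} (hv : v.IsSmooth) :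
    locConserved v = conserved v (closedForms E M) := by
  ext α
  exact ⟨fun hα => ⟨hα.1, hα.1.lie hv, hα.2⟩, fun hα => ⟨hα.1, hα.2.2⟩⟩

end GradedSubspaces

section Observables

variable {E : Type*} [NormedAddCommGroup E] [NormedSpace ℝ E]
  {M : Type*} [TopologicalSpace M] [ChartedSpace E M]
  [IsManifold 𝓘(ℝ, E) ((⊤ : ℕ∞) : WithTop ℕ∞) M] {n : ℕ} {ω : DForm E M (n + 1)}

theorem IsHamiltonianField.ι_eq {α : DForm E M (n - 1)} {w : VField E M}
    (hw : IsHamiltonianField ω α w) : ω.homog.ι w = -α.homog.d :=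
  neg_eq_iff_eq_neg.1 hw.2.symm

theorem IsHamiltonianField.d_ι {α : DForm E M (n - 1)} {w : VField E M}
    (hw : IsHamiltonianField ω α w) (hα : α.IsSmooth) : (ω.homog.ι w).d = 0 := by
  rw [hw.ι_eq, GForm.d_neg, GForm.d_d hα.homog, neg_zero]

theorem IsHamiltonianField.lie_ι {α : DForm E M (n - 1)} {v w : VField E M}
    (hw : IsHamiltonianField ω α w) (hα : α.IsSmooth) (hv : v.IsSmooth)
    (hvα : (α.homog.lie v).d = 0) : (ω.homog.ι w).lie v = 0 := by
  rw [hw.ι_eq, GForm.lie_neg, GForm.lie_d hα.homog hv, hvα, neg_zero]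

theorem IsHamiltonian.isHamiltonianField_hamField {α : DForm E M (n - 1)}
    (hα : IsHamiltonian ω α) : IsHamiltonianField ω α (hamField ω α) := by
  rw [hamField, dif_pos hα.2]
  exact hα.2.choose_spec

theorem IsHamiltonian.of_d_eq_zero {α : DForm E M (n - 1)} (hα : α.IsSmooth) (hdα : α.d = 0) :
    IsHamiltonian ω α :=
  ⟨hα, 0, .zero, by rw [DForm.d_homog, hdα, DForm.homog_zero, GForm.ι_zero_left, neg_zero]⟩

theorem IsHamiltonian.zero : IsHamiltonian ω 0 :=
  .of_d_eq_zero .zero DForm.d_zero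

theorem IsHamiltonian.add {α β : DForm E M (n - 1)} (hα : IsHamiltonian ω α)
    (hβ : IsHamiltonian ω β) : IsHamiltonian ω (α + β) := by
  obtain ⟨hα, v, hv, hvα⟩ := hα
  obtain ⟨hβ, w, hw, hwβ⟩ := hβ
  refine ⟨hα.add hβ, v + w, hv.add hw, ?_⟩
  rw [DForm.homog_add, GForm.d_add hα.homog hβ.homog, hvα, hwβ, GForm.ι_add_left, neg_add]

theorem IsHamiltonian.smul (c : ℝ) {α : DForm E M (n - 1)} (hα : IsHamiltonian ω α) :
    IsHamiltonian ω (c • α) := by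
  obtain ⟨hα, v, hv, hvα⟩ := hα
  refine ⟨hα.smul c, c • v, hv.smul c, ?_⟩
  rw [DForm.homog_smul, GForm.d_smul, hvα, GForm.ι_smul_left, smul_neg]

variable (ω) in
theorem isGradedSubspace_observables : IsGradedSubspace (observables ω) where
  zero_mem := ⟨.zero, fun _ _ => rfl, .zero⟩
  add_mem _ hα _ hβ :=
    ⟨hα.1.add hβ.1, fun p hp => by rw [Pi.add_apply, hα.2.1 p hp, hβ.2.1 p hp, add_zero],
      hα.2.2.add hβ.2.2⟩
  smul_mem c _ hα :=
    ⟨hα.1.smul c, fun p hp => by rw [Pi.smul_apply, hα.2.1 p hp, smul_zero], hα.2.2.smul c⟩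
  component_mem α hα p := by
    refine ⟨(hα.1 p).homog, fun q hq => ?_, ?_⟩
    · obtain rfl | h := eq_or_ne q p
      · rw [DForm.homog_self, hα.2.1 q hq]
      · exact DForm.homog_of_ne _ h
    · obtain rfl | h := eq_or_ne (n - 1) p
      · rw [DForm.homog_self]
        exact hα.2.2
      · rw [DForm.homog_of_ne _ h]
        exact .zero

theorem bracket_one_apply (β : Fin 1 → GForm E M) (p : ℕ) :
    bracket ω 1 β p = if p < n then (β 0).d p else 0 := rfl

theorem bracket_one_mem_observables (hn : 1 ≤ n) {β : Fin 1 → GForm E M}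
    (hβ : (β 0).IsSmooth) : bracket ω 1 β ∈ observables ω := by
  refine ⟨fun p => ?_, fun p hp => if_neg hp.not_gt, ?_⟩
  · rw [bracket_one_apply]
    split_ifs
    · exact hβ.d p
    · exact .zero
  · rw [bracket_one_apply, if_pos (by omega)]
    exact .of_d_eq_zero (hβ.d _) (congrFun (GForm.d_d hβ) (n - 1 + 1))

theorem lie_bracket_one_eq_zero {v : VField E M} (hv : v.IsSmooth) {β : Fin 1 → GForm E M}
    (hβ : β 0 ∈ locConserved v) : (bracket ω 1 β).lie v = 0 := by
  have lie_d_eq_zero : (β 0).d.lie v = 0 := by rw [GForm.lie_d hβ.1 hv, hβ.2]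
  funext p
  change (bracket ω 1 β p).lie v = 0
  rw [bracket_one_apply]
  split_ifs
  · exact congrFun lie_d_eq_zero p
  · exact DForm.lie_zero v

theorem bracket_add_two_apply_eq_zero {k p : ℕ} (β : Fin (k + 2) → GForm E M)
    (hp : p + (k + 2) ≠ n + 1) : bracket ω (k + 2) β p = 0 := by
  change bracketSign (k + 2) • GForm.contract (k + 2) _ ω.homog p = 0
  rw [GForm.contract_apply_eq_zero _ (DForm.homog_of_ne _ hp), smul_zero]

theorem isSmooth_bracket_add_two (hω : ω.IsSmooth) {k : ℕ} {β : Fin (k + 2) → GForm E M}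
    (hβ : ∀ j, IsHamiltonian ω (β j (n - 1))) : (bracket ω (k + 2) β).IsSmooth :=
  .smul _ (.contract (fun j => (hβ j).isHamiltonianField_hamField.1) hω.homog)

theorem bracketSign_two : bracketSign 2 = 1 := by norm_num [bracketSign]

theorem isHamiltonianField_bracket_two [CompleteSpace E] (hn : 1 ≤ n) (hω : IsPrePlectic ω)
    {β : Fin 2 → GForm E M} (hβ : ∀ j, (β j (n - 1)).IsSmooth) {w : Fin 2 → VField E M}
    (hw : ∀ j, IsHamiltonianField ω (β j (n - 1)) (w j)) :
    IsHamiltonianField ω (bracket ω 2 β (n - 1))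
      (VectorField.mlieBracket 𝓘(ℝ, E) (w 0) (w 1)) := by
  have d_homog_eq_zero : ω.homog.d = 0 := by rw [DForm.d_homog, hω.2, DForm.homog_zero]
  have bracket_eq_ι_ι : bracket ω 2 β = (ω.homog.ι (w 0)).ι (w 1) := by
    refine (bracket_eq ω 0 β w hw).trans ?_
    change bracketSign 2 • (ω.homog.ι (w 0)).ι (w 1) = _
    rw [bracketSign_two, one_smul]
  refine ⟨(hw 0).1.mlieBracket (hw 1).1, ?_⟩
  rw [GForm.homog_component fun p hp => bracket_add_two_apply_eq_zero β (by omega),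
    bracket_eq_ι_ι, GForm.d_ι_ι hω.1.homog d_homog_eq_zero (hw 0).1 (hw 1).1
      ((hw 0).d_ι (hβ 0)) ((hw 1).d_ι (hβ 1)), VectorField.mlieBracket_swap]
  exact GForm.ι_neg_left _ _

theorem bracket_add_two_mem_observables [CompleteSpace E] (hn : 1 ≤ n) (hω : IsPrePlectic ω)
    {k : ℕ} {β : Fin (k + 2) → GForm E M} (hβ : ∀ j, IsHamiltonian ω (β j (n - 1))) :
    bracket ω (k + 2) β ∈ observables ω := by
  have isSmooth_bracket := isSmooth_bracket_add_two hω.1 hβ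
  refine ⟨isSmooth_bracket, fun p hp => bracket_add_two_apply_eq_zero β (by omega), ?_⟩
  cases k with
  | zero =>
    exact ⟨isSmooth_bracket _, _, isHamiltonianField_bracket_two hn hω (fun j => (hβ j).1)
      fun j => (hβ j).isHamiltonianField_hamField⟩
  | succ k =>
    rw [bracket_add_two_apply_eq_zero β (by omega)]
    exact .zero

theorem lie_bracket_add_two_eq_zero (hω : ω.IsSmooth) {v : VField E M} (hv : v.IsSmooth)
    (hvω : ω.lie v = 0) {k : ℕ} {β : Fin (k + 2) → GForm E M}
    (hβ : ∀ j, IsHamiltonian ω (β j (n - 1))) (hvβ : ∀ j, β j ∈ locConserved v) :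
    (bracket ω (k + 2) β).lie v = 0 := by
  have hamField_spec j := (hβ j).isHamiltonianField_hamField
  have lie_homog_eq_zero : ω.homog.lie v = 0 := by rw [DForm.lie_homog, hvω, DForm.homog_zero]
  have d_lie_eq_zero j : ((β j (n - 1)).homog.lie v).d = 0 := by
    have d_lie_component : ((β j (n - 1)).lie v).d = 0 := congrFun (hvβ j).2 (n - 1 + 1)
    rw [DForm.lie_homog, DForm.d_homog, d_lie_component, DForm.homog_zero]
  rw [bracket, GForm.lie_smul, GForm.lie_contract_eq_zero (fun j => (hamField_spec j).1) hω.homog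
    lie_homog_eq_zero fun j => (hamField_spec j).lie_ι (hβ j).1 hv (d_lie_eq_zero j), smul_zero]

theorem bracket_mem_observables [CompleteSpace E] (hn : 1 ≤ n) (hω : IsPrePlectic ω) :
    ∀ {k : ℕ} {β : Fin k → GForm E M}, (∀ j, β j ∈ observables ω) →
      bracket ω k β ∈ observables ω
  | 0, _, _ => (isGradedSubspace_observables ω).zero_mem
  | 1, _, hβ => bracket_one_mem_observables hn (hβ 0).1
  | _ + 2, _, hβ => bracket_add_two_mem_observables hn hω fun j => (hβ j).2.2

theorem lie_bracket_eq_zero (hω : ω.IsSmooth) {v : VField E M} (hv : v.IsSmooth)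
    (hvω : ω.lie v = 0) :
    ∀ {k : ℕ} {β : Fin k → GForm E M}, (∀ j, β j ∈ observables ω ∩ locConserved v) →
      (bracket ω k β).lie v = 0
  | 0, _, _ => GForm.lie_zero v
  | 1, _, hβ => lie_bracket_one_eq_zero hv (hβ 0).2
  | _ + 2, _, hβ =>
    lie_bracket_add_two_eq_zero hω hv hvω (fun j => (hβ j).1.2.2) fun j => (hβ j).2

theorem isLInftySubalgebra_observables_inter_conserved [CompleteSpace E] (hn : 1 ≤ n)
    (hω : IsPrePlectic ω) {v : VField E M} (hv : v.IsSmooth) (hvω : ω.lie v = 0)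
    {T : Set (GForm E M)} (hT : IsGradedSubspace T) (hT_closed : T ⊆ closedForms E M) :
    IsLInftySubalgebra ω (observables ω ∩ conserved v T) := by
  have isGradedSubspace_inter := (isGradedSubspace_observables ω).inter (hT.conserved v)
  refine { isGradedSubspace_inter with subset := Set.inter_subset_left, bracket_mem := ?_ }
  intro k _ β hβ
  have bracket_mem := bracket_mem_observables hn hω fun j => (hβ j).1
  have lie_bracket : (bracket ω k β).lie v = 0 := lie_bracket_eq_zero hω.1 hv hvω fun j =>
    ⟨(hβ j).1, (hβ j).2.1, (hT_closed (hβ j).2.2).2⟩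
  exact ⟨bracket_mem, bracket_mem.1, lie_bracket ▸ hT.zero_mem⟩

end Observables

end Multisymplectic

theorem mainTheorem7_general
    {E : Type*} [NormedAddCommGroup E] [NormedSpace ℝ E] [CompleteSpace E]
    {M : Type*} [TopologicalSpace M] [ChartedSpace E M]
    [IsManifold 𝓘(ℝ, E) ((⊤ : ℕ∞) : WithTop ℕ∞) M]
    (n : ℕ) (hn : 1 ≤ n)
    (ω : Multisymplectic.DForm E M (n + 1)) (hω : Multisymplectic.IsPrePlectic ω)
    (v : Multisymplectic.VField E M) (hv : v.IsSmooth) (hvω : ω.lie v = 0) :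
    Multisymplectic.IsLInftySubalgebra ω
        (Multisymplectic.observables ω ∩ Multisymplectic.locConserved v) ∧
      Multisymplectic.IsLInftySubalgebra ω
        (Multisymplectic.observables ω ∩ Multisymplectic.globConserved v) ∧
      Multisymplectic.IsLInftySubalgebra ω
        (Multisymplectic.observables ω ∩ Multisymplectic.strictConserved v) ∧
      ∀ k : ℕ, 1 ≤ k → ∀ β : Fin k → Multisymplectic.GForm E M,
        (∀ j, β j ∈ Multisymplectic.observables ω ∩ Multisymplectic.locConserved v) →
          (Multisymplectic.bracket ω k β).lie v = 0 := by
  refine ⟨?_, ?_, ?_, fun k _ β hβ => Multisymplectic.lie_bracket_eq_zero hω.1 hv hvω hβ⟩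
  · rw [Multisymplectic.locConserved_eq_conserved hv]
    exact Multisymplectic.isLInftySubalgebra_observables_inter_conserved hn hω hv hvω
      Multisymplectic.isGradedSubspace_closedForms subset_rfl
  · rw [Multisymplectic.globConserved_eq_conserved]
    exact Multisymplectic.isLInftySubalgebra_observables_inter_conserved hn hω hv hvω
      Multisymplectic.isGradedSubspace_exactForms Multisymplectic.exactForms_subset_closedForms
  · rw [Multisymplectic.strictConserved_eq_conserved]
    exact Multisymplectic.isLInftySubalgebra_observables_inter_conserved hn hω hv hvω
      Multisymplectic.isGradedSubspace_singleton_zero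
      (Set.singleton_subset_iff.2 Multisymplectic.isGradedSubspace_closedForms.zero_mem)

theorem mainTheorem7
    {E : Type*} [NormedAddCommGroup E] [NormedSpace ℝ E] [FiniteDimensional ℝ E]
    {M : Type*} [TopologicalSpace M] [ChartedSpace E M]
    [IsManifold 𝓘(ℝ, E) ((⊤ : ℕ∞) : WithTop ℕ∞) M]
    (n : ℕ) (hn : 1 ≤ n)
    (ω : Multisymplectic.DForm E M (n + 1)) (hω : Multisymplectic.IsPrePlectic ω)
    (v : Multisymplectic.VField E M) (hv : v.IsSmooth) (hvω : ω.lie v = 0) :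
    Multisymplectic.IsLInftySubalgebra ω
        (Multisymplectic.observables ω ∩ Multisymplectic.locConserved v) ∧
      Multisymplectic.IsLInftySubalgebra ω
        (Multisymplectic.observables ω ∩ Multisymplectic.globConserved v) ∧
      Multisymplectic.IsLInftySubalgebra ω
        (Multisymplectic.observables ω ∩ Multisymplectic.strictConserved v) ∧
      ∀ k : ℕ, 1 ≤ k → ∀ β : Fin k → Multisymplectic.GForm E M,
        (∀ j, β j ∈ Multisymplectic.observables ω ∩ Multisymplectic.locConserved v) →
          (Multisymplectic.bracket ω k β).lie v = 0 := by
  have : CompleteSpace E := FiniteDimensional.complete ℝ E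
  exact mainTheorem7_general n hn ω hω v hv hvω
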